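/- Let $T,L>0$. There is a constant $C=C_{T,L}>0$, depending only on $T$ and $L$, such that the following holds. Let $H\in(0,1/2)$, $d,N,M\in\mathbb N$ with $N,M\ge 1$, and let $\mathcal P_2(\mathbb R^d)$ be the set of probability measures on $\mathbb R^d$ with finite second moment, with the $2$-Wasserstein distance $\mathcal W_2$. Let $b:\mathbb R^d\times\mathcal P_2(\mathbb R^d)\to\mathbb R^d$ and $\xi\in\mathbb R^{d}\otimes\mathbb R^d$ (a constant diffusion coefficient) satisfy $$|b(x,\mu)-b(y,\nu)|\le L\big(|x-y|+\mathcal W_2(\mu,\nu)\big)\quad\text{for all }x,y\in\mathbb R^d,\ \mu,\nu\in\mathcal P_2(\mathbb R^d),\qquad |b(0,\delta_0)|\vee|\xi|\le L,$$ where $|\cdot|$ is the Euclidean norm (the Hilbert–Schmidt norm for $\xi$). On a probability space let $X_0^1,\dots,X_0^N$ be identically distributed, square-integrable random vectors in $\mathbb R^d$, and let $B^{H,1},\dots,B^{H,N}$ be $d$-dimensional fractional Brownian motions on $[0,T]$ with Hurst parameter $H$ and continuous paths (independence of the particles is not needed). Let $X^{1,N},\dots,X^{N,N}$ be processes with continuous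 paths that almost surely solve the interacting particle system $$X^{i,N}_t=X_0^i+\int_0^t b\big(X^{i,N}_s,\mu^{X,N}_s\big)\,\mathrm ds+\int_0^t\xi\,\mathrm dB^{H,i}_s,\qquad \mu^{X,N}_s=\frac1N\sum_{j=1}^N\delta_{X^{j,N}_s},\qquad t\in[0,T].$$ Put $\Delta=T/M$, $t_k=k\Delta$, and let $Y^{i,N}$ be the Euler–Maruyama approximation: $Y^{i,N}_{0}=X^i_0$, $$Y^{i,N}_{t_{k+1}}=Y^{i,N}_{t_k}+b\big(Y^{i,N}_{t_k},\mu^{Y,N}_{t_k}\big)\Delta+\xi\big(B^{H,i}_{t_{k+1}}-B^{H,i}_{t_k}\big),\qquad \mu^{Y,N}_{t_k}=\frac1N\sum_{j=1}^N\delta_{Y^{j,N}_{t_k}},$$ extended to $[0,T]$ by $$Y^{i,N}_t=Y^{i,N}_{t_k}+\int_{t_k}^t b\big(\bar Y^{i,N}_s,\bar\mu^{Y,N}_s\big)\,\mathrm ds+\int_{t_k}^t\xi\,\mathrm dB^{H,i}_s,\qquad t_k\le t<t_{k+1},$$ where $\bar Y^{i,N}_s=Y^{i,N}_{t_k}$ for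 $t_k\le s<t_{k+1}$ and $\bar\mu^{Y,N}_s=\frac1N\sum_{j=1}^N\delta_{\bar Y^{j,N}_s}$. Then for all $t\in[0,T]$ and $i\in\{1,\dots,N\}$ the random variable $|X^{i,N}_t-Y^{i,N}_t|^2$ is integrable and $$\mathbf E\big|X^{i,N}_t-Y^{i,N}_t\big|^2\le C\,\big(1+\mathbf E|X^i_0|^2\big)\,\Delta^{2H}.$$ -/

import Mathlib

open MeasureTheory ProbabilityTheory Set
open scoped ENNReal

namespace FBMParticles

/-- `ℝ^d` with its Euclidean norm. -/
abbrev Vec (d : ℕ) : Type := EuclideanSpace ℝ (Fin d)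

/-- `𝒫₂(ℝ^d)`: the Borel probability measures on `ℝ^d` with finite second moment. -/
def P2 (d : ℕ) : Type :=
  {μ : Measure (Vec d) // IsProbabilityMeasure μ ∧ ∫⁻ x, ‖x‖ₑ ^ 2 ∂μ < ∞}

/-- `Π(μ, ν)`: the measures on `ℝ^d × ℝ^d` with marginals `μ` and `ν`. -/
def couplings {d : ℕ} (μ ν : P2 d) : Set (Measure (Vec d × Vec d)) :=
  {π | π.map Prod.fst = μ.1 ∧ π.map Prod.snd = ν.1}

/-- The 2-Wasserstein distance on `𝒫₂(ℝ^d)`. The infimum is taken in `[0, ∞]`; it is finite on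
`𝒫₂(ℝ^d)`, so that nothing is lost in passing to a real number. -/
noncomputable def W2 {d : ℕ} (μ ν : P2 d) : ℝ :=
  ((⨅ π ∈ couplings μ ν, ∫⁻ z, ‖z.1 - z.2‖ₑ ^ 2 ∂π) ^ (1 / 2 : ℝ)).toReal

/-- The Dirac measure at `x`. -/
noncomputable def diracP2 {d : ℕ} (x : Vec d) : P2 d :=
  ⟨Measure.dirac x, inferInstance, by
    rw [lintegral_dirac' _ (by fun_prop)]
    exact ENNReal.pow_lt_top enorm_lt_top⟩

/-- The empirical measure `(1/N) ∑ⱼ δ_{xⱼ}` of `N ≥ 1` points. -/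
noncomputable def empirical {d N : ℕ} [NeZero N] (x : Fin N → Vec d) : P2 d :=
  ⟨(N : ℝ≥0∞)⁻¹ • ∑ j, Measure.dirac (x j), by
    have hN : (N : ℝ≥0∞) ≠ 0 := by exact_mod_cast NeZero.ne N
    constructor
    · constructor
      simp [ENNReal.inv_mul_cancel hN (ENNReal.natCast_ne_top N)]
    · rw [lintegral_smul_measure, lintegral_finsetSum_measure]
      refine ENNReal.mul_lt_top (ENNReal.inv_lt_top.2 (pos_iff_ne_zero.2 hN)) ?_
      refine ENNReal.sum_lt_top.2 fun j _ => ?_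
      rw [lintegral_dirac' _ (by fun_prop)]
      exact ENNReal.pow_lt_top enorm_lt_top⟩

/-- The Euclidean (Hilbert–Schmidt) norm on `ℝ^d ⊗ ℝ^d`, seen as `d × d` matrices. -/
noncomputable def hsNorm {d : ℕ} (A : Matrix (Fin d) (Fin d) ℝ) : ℝ :=
  Real.sqrt (∑ i, ∑ j, A i j ^ 2)

/-- The standing assumption on the coefficients, with constant `L`: the drift `b` and the diffusion
coefficient `σ` are globally Lipschitz, and bounded by `L` at the origin. -/
structure LipschitzCoefficients {d : ℕ} (L : ℝ) (b : Vec d → P2 d → Vec d)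
    (σ : P2 d → Matrix (Fin d) (Fin d) ℝ) : Prop where
  drift : ∀ x y μ ν, ‖b x μ - b y ν‖ ≤ L * (‖x - y‖ + W2 μ ν)
  diffusion : ∀ μ ν, hsNorm (σ μ - σ ν) ≤ L * W2 μ ν
  origin : max ‖b 0 (diracP2 0)‖ (hsNorm (σ (diracP2 0))) ≤ L

/-- The covariance `R_H(t, s)` of one-dimensional fractional Brownian motion. -/
noncomputable def fbmCov (H t s : ℝ) : ℝ :=
  (1 / 2) * (t ^ (2 * H) + s ^ (2 * H) - |t - s| ^ (2 * H))

/-- `B` is on `[0, T]` a `d`-dimensional fractional Brownian motion with Hurst parameter `H`: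
a centered Gaussian process with almost surely continuous paths, the coordinates of which are
uncorrelated (hence independent) and have covariance `R_H`. -/
structure IsFBM {d : ℕ} {Ω : Type*} [MeasurableSpace Ω] (P : Measure Ω) (H T : ℝ)
    (B : ℝ → Ω → Vec d) : Prop where
  gaussian : IsGaussianProcess (fun t : Icc (0 : ℝ) T => B t) P
  centered : ∀ t ∈ Icc 0 T, ∫ ω, B t ω ∂P = 0
  covariance : ∀ t ∈ Icc 0 T, ∀ s ∈ Icc 0 T, ∀ k l : Fin d,
    ∫ ω, B t ω k * B s ω l ∂P = if k = l then fbmCov H t s else 0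
  continuous_paths : ∀ᵐ ω ∂P, ContinuousOn (fun t => B t ω) (Icc 0 T)

/-- The integral `∫_s^t ξ dw` of a constant matrix `ξ` against a path `w`, which is
`ξ (w_t - w_s)`. -/
noncomputable def constIntegral {d : ℕ} (ξ : Matrix (Fin d) (Fin d) ℝ) (w : ℝ → Vec d)
    (s t : ℝ) : Vec d :=
  Matrix.toEuclideanCLM (𝕜 := ℝ) ξ (w t - w s)

/-- `X` solves on `[0, T]` the interacting particle system
`X^i_t = X^i_0 + ∫_0^t b(X^i_s, μ_s) ds + ∫_0^t ξ dB^i_s`, where `μ_s` is the empirical measure of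
`X^1_s, …, X^N_s`: it is a process with almost surely continuous paths, and almost surely
satisfies the equations at all times. -/
structure IsParticleSystem {d N : ℕ} [NeZero N] {Ω : Type*} [MeasurableSpace Ω] (P : Measure Ω)
    (T : ℝ) (b : Vec d → P2 d → Vec d) (ξ : Matrix (Fin d) (Fin d) ℝ)
    (X₀ : Fin N → Ω → Vec d) (B X : Fin N → ℝ → Ω → Vec d) : Prop where
  measurable : ∀ i, ∀ t ∈ Icc 0 T, AEMeasurable (X i t) P
  continuous_paths : ∀ i, ∀ᵐ ω ∂P, ContinuousOn (fun t => X i t ω) (Icc 0 T)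
  equation : ∀ i, ∀ᵐ ω ∂P, ∀ t ∈ Icc 0 T,
    X i t ω = X₀ i ω + (∫ s in 0..t, b (X i s ω) (empirical fun j => X j s ω))
      + constIntegral ξ (fun s => B i s ω) 0 t

section EulerMaruyama

/- The scheme is defined path by path: `x₀` are the initial points of the particles, `w` the paths
of the driving noises, `Δ` is the step size. -/

variable {d N : ℕ} [NeZero N] (b : Vec d → P2 d → Vec d) (ξ : Matrix (Fin d) (Fin d) ℝ)
  (x₀ : Fin N → Vec d) (w : Fin N → ℝ → Vec d) (Δ : ℝ)

/-- The values `Y^i_{t_k}` of the Euler–Maruyama method at the mesh points `t_k = k Δ`. -/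
noncomputable def emNode : ℕ → Fin N → Vec d
  | 0 => x₀
  | k + 1 => fun i => emNode k i + Δ • b (emNode k i) (empirical (emNode k))
      + constIntegral ξ (w i) (k * Δ) ((k + 1) * Δ)

/-- The piecewise constant extension: the value at `t` is `Y^i_{t_k}` for `t_k ≤ t < t_{k+1}`. -/
noncomputable def emStep (t : ℝ) : Fin N → Vec d :=
  emNode b ξ x₀ w Δ ⌊t / Δ⌋₊

/-- The continuous extension: for `t_k ≤ t < t_{k+1}` the value at `t` is
`Y^i_{t_k} + ∫_{t_k}^t b(Ȳ^i_s, μ̄_s) ds + ∫_{t_k}^t ξ dw^i_s`, where `Ȳ` is the piecewise constant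
extension and `μ̄_s` is the empirical measure of `Ȳ^1_s, …, Ȳ^N_s`. -/
noncomputable def emInterp (t : ℝ) (i : Fin N) : Vec d :=
  emNode b ξ x₀ w Δ ⌊t / Δ⌋₊ i
    + (∫ s in (⌊t / Δ⌋₊ * Δ)..t, b (emStep b ξ x₀ w Δ s i) (empirical (emStep b ξ x₀ w Δ s)))
    + constIntegral ξ (w i) (⌊t / Δ⌋₊ * Δ) t

end EulerMaruyama

end FBMParticles

/-! Since `ξ` is constant, the particle system and the continuous extension `Y` of the scheme carry
the same noise term, which cancels in the difference: path by path, `X_t - Y_t` is the time integral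
of the drift at `X` minus the drift at the step process `Ȳ`. No stochastic calculus is needed. The
Lipschitz condition, Cauchy–Schwarz in time and Grönwall bound the squared error by a multiple of
the time integral of the distance from `Y` to `Ȳ` (`sq_norm_sub_emInterp_le`).

The particles interact through their empirical measure, and pairing particles of equal index bounds
`W2` by the mean square distance. The estimate for particle `i` thus involves this particle and the
mean over all particles. Their sum `energy i` satisfies a closed inequality for each fixed `i`, so
neither exchangeability nor independence is required.

In mean square, `Y - Ȳ` over one step consists of a drift of order `Δ ^ 2` and a noise increment of
order `Δ ^ (2 * H)`; the latter dominates (`integral_sq_emInterp_sub_emStep_le`). The drift part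
needs second moments of the nodes uniformly in the mesh (`integral_sq_emNode_le`). They come from
the summed form of the scheme, where the noise telescopes to a single increment from time `0`.
Adding the variances of the single steps would give `T * Δ ^ (2 * H - 1)`, which is unbounded for `H
< 1/2`.

Expectations are first taken as lower Lebesgue integrals and exchanged with the time integral by
Tonelli, so integrability of the error is a conclusion rather than an assumption on `X`. -/

namespace FBMParticles

/-! ### Empirical measures and the energy of a configuration -/

section Empirical

variable {d N : ℕ}

/-- The squared norm of the `i`-th particle plus the mean of the squared norms of all particles. -/
noncomputable def energy (i : Fin N) (z : Fin N → Vec d) : ℝ :=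
  ‖z i‖ ^ 2 + (N : ℝ)⁻¹ * ∑ j, ‖z j‖ ^ 2

lemma W2_empirical_sq_le [NeZero N] (x y : Fin N → Vec d) :
    W2 (empirical x) (empirical y) ^ 2 ≤ (N : ℝ)⁻¹ * ∑ j, ‖x j - y j‖ ^ 2 := by
  have hN : (N : ℝ≥0∞) ≠ 0 := by exact_mod_cast NeZero.ne N
  -- The coupling that pairs particles of equal index; it need not be optimal.
  set π : Measure (Vec d × Vec d) := (N : ℝ≥0∞)⁻¹ • ∑ j, Measure.dirac (x j, y j) with hπ
  have hmem : π ∈ couplings (empirical x) (empirical y) := by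
    constructor
    · simp only [hπ, empirical, Measure.map_smul]
      rw [Measure.map_finset_sum (by fun_prop)]
      simp [Measure.map_dirac' measurable_fst]
    · simp only [hπ, empirical, Measure.map_smul]
      rw [Measure.map_finset_sum (by fun_prop)]
      simp [Measure.map_dirac' measurable_snd]
  have hint : ∫⁻ z, ‖z.1 - z.2‖ₑ ^ 2 ∂π
      = ENNReal.ofReal ((N : ℝ)⁻¹ * ∑ j, ‖x j - y j‖ ^ 2) := by
    rw [hπ, lintegral_smul_measure, lintegral_finsetSum_measure,
      ENNReal.ofReal_mul (by positivity), ENNReal.ofReal_sum_of_nonneg (fun _ _ => by positivity),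
      ENNReal.ofReal_inv_of_pos (by exact_mod_cast NeZero.pos N), ENNReal.ofReal_natCast, smul_eq_mul]
    congr 1
    refine Finset.sum_congr rfl fun j _ => ?_
    rw [lintegral_dirac' _ (by fun_prop), ENNReal.ofReal_pow (norm_nonneg _), ofReal_norm]
  have hle := iInf₂_le (f := fun π (_ : π ∈ couplings (empirical x) (empirical y)) =>
    ∫⁻ z, ‖z.1 - z.2‖ₑ ^ 2 ∂π) π hmem
  rw [hint] at hle
  have h2 := ENNReal.toReal_mono ENNReal.ofReal_ne_top hle
  rw [ENNReal.toReal_ofReal (by positivity)] at h2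
  refine le_trans (le_of_eq ?_) h2
  rw [W2, ← ENNReal.toReal_pow, ← ENNReal.rpow_natCast, ← ENNReal.rpow_mul]
  norm_num

lemma empirical_zero [NeZero N] : empirical (fun _ : Fin N => (0 : Vec d)) = diracP2 0 := by
  have hN : (N : ℝ≥0∞) ≠ 0 := by exact_mod_cast NeZero.ne N
  apply Subtype.ext
  simp only [empirical, diracP2, Finset.sum_const, Finset.card_univ, Fintype.card_fin]
  rw [← Nat.cast_smul_eq_nsmul ℝ≥0∞, smul_smul,
    ENNReal.inv_mul_cancel hN (ENNReal.natCast_ne_top N), one_smul]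

lemma energy_nonneg (i : Fin N) (z : Fin N → Vec d) : 0 ≤ energy i z := by
  unfold energy; positivity

lemma norm_sq_le_energy (i : Fin N) (z : Fin N → Vec d) : ‖z i‖ ^ 2 ≤ energy i z := by
  unfold energy
  have : 0 ≤ (N : ℝ)⁻¹ * ∑ j, ‖z j‖ ^ 2 := by positivity
  linarith

@[fun_prop]
lemma continuous_energy (i : Fin N) : Continuous (energy i : (Fin N → Vec d) → ℝ) := by
  unfold energy; fun_prop

lemma norm_add_sq_le_two_mul {E : Type*} [SeminormedAddCommGroup E] (u v : E) :
    ‖u + v‖ ^ 2 ≤ 2 * ‖u‖ ^ 2 + 2 * ‖v‖ ^ 2 := by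
  nlinarith [norm_add_le u v, norm_nonneg (u + v), sq_nonneg (‖u‖ - ‖v‖)]

lemma energy_add_le (i : Fin N) (u v : Fin N → Vec d) :
    energy i (u + v) ≤ 2 * energy i u + 2 * energy i v := by
  have hs : ∑ j, ‖(u + v) j‖ ^ 2 ≤ 2 * ∑ j, ‖u j‖ ^ 2 + 2 * ∑ j, ‖v j‖ ^ 2 := by
    rw [Finset.mul_sum, Finset.mul_sum, ← Finset.sum_add_distrib]
    exact Finset.sum_le_sum fun j _ => norm_add_sq_le_two_mul (u j) (v j)
  have h := mul_le_mul_of_nonneg_left hs (inv_nonneg.2 (Nat.cast_nonneg (α := ℝ) N))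
  have h1 := norm_add_sq_le_two_mul (u i) (v i)
  simp only [energy]
  rw [Pi.add_apply] at *
  linarith

lemma mean_const [NeZero N] (c : ℝ) : (N : ℝ)⁻¹ * ∑ _j : Fin N, c = c := by
  have hN : (N : ℝ) ≠ 0 := by exact_mod_cast NeZero.ne N
  simp [hN]

lemma mean_energy [NeZero N] (z : Fin N → Vec d) :
    (N : ℝ)⁻¹ * ∑ j, energy j z = 2 * ((N : ℝ)⁻¹ * ∑ j, ‖z j‖ ^ 2) := by
  simp only [energy, Finset.sum_add_distrib, mul_add, mean_const]
  ring

/-- A bound of each particle of `z` by the energy of `y`, in mean over a measure, carries over to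
the energy of `z`. -/
lemma energy_le_integral [NeZero N] {α : Type*} [MeasurableSpace α] {μ : Measure α} {z : Fin N → Vec d}
    {y : α → Fin N → Vec d} {c : ℝ} (hc : 0 ≤ c) (hy : ∀ j, Integrable (fun s => energy j (y s)) μ)
    (h : ∀ j, ‖z j‖ ^ 2 ≤ c * ∫ s, energy j (y s) ∂μ) (i : Fin N) :
    energy i z ≤ 3 * c * ∫ s, energy i (y s) ∂μ := by
  -- Averaging the energies over all particles gives twice the mean square, hence at most twice the
  -- energy of any one particle. With particle `i` itself this makes the factor 3.
  have hmean : (N : ℝ)⁻¹ * ∑ j, ∫ s, energy j (y s) ∂μ ≤ 2 * ∫ s, energy i (y s) ∂μ := by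
    rw [← integral_finsetSum _ fun j _ => hy j, ← integral_const_mul, ← integral_const_mul]
    refine integral_mono ((integrable_finsetSum _ fun j _ => hy j).const_mul _)
      ((hy i).const_mul _) fun s => ?_
    simp only [mean_energy]
    unfold energy
    nlinarith [sq_nonneg ‖y s i‖]
  have hs := mul_le_mul_of_nonneg_left (Finset.sum_le_sum fun j (_ : j ∈ Finset.univ) => h j)
    (inv_nonneg.2 (Nat.cast_nonneg (α := ℝ) N))
  rw [← Finset.mul_sum] at hs
  have h2 := mul_le_mul_of_nonneg_left hmean hc
  have h3 := h i
  unfold energy at h3 h2 hs ⊢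
  linarith

end Empirical

/-! ### The drift along empirical measures -/

section Drift

variable {d N : ℕ} [NeZero N] {L : ℝ} {b : Vec d → P2 d → Vec d}
  {σ : P2 d → Matrix (Fin d) (Fin d) ℝ}

lemma LipschitzCoefficients.nonneg (hb : LipschitzCoefficients L b σ) : 0 ≤ L :=
  (norm_nonneg _).trans ((le_max_left _ _).trans hb.origin)

lemma LipschitzCoefficients.drift_sub_sq_le (hb : LipschitzCoefficients L b σ)
    (x y : Fin N → Vec d) (i : Fin N) :
    ‖b (x i) (empirical x) - b (y i) (empirical y)‖ ^ 2 ≤ 2 * L ^ 2 * energy i (x - y) := by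
  have h := hb.drift (x i) (y i) (empirical x) (empirical y)
  have hw := W2_empirical_sq_le x y
  have h2 := pow_le_pow_left₀ (norm_nonneg _) h 2
  have h3 : (‖x i - y i‖ + W2 (empirical x) (empirical y)) ^ 2
      ≤ 2 * energy i (x - y) := by
    simp only [energy, Pi.sub_apply]
    nlinarith [sq_nonneg (‖x i - y i‖ - W2 (empirical x) (empirical y))]
  calc _ ≤ _ := h2
    _ = L ^ 2 * (‖x i - y i‖ + W2 (empirical x) (empirical y)) ^ 2 := by ring
    _ ≤ L ^ 2 * (2 * energy i (x - y)) := by gcongr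
    _ = _ := by ring

lemma LipschitzCoefficients.drift_sq_le (hb : LipschitzCoefficients L b σ)
    (x : Fin N → Vec d) (i : Fin N) :
    ‖b (x i) (empirical x)‖ ^ 2 ≤ 2 * L ^ 2 + 4 * L ^ 2 * energy i x := by
  have h := hb.drift_sub_sq_le x (fun _ => 0) i
  rw [empirical_zero] at h
  have h0 : ‖b 0 (diracP2 0)‖ ^ 2 ≤ L ^ 2 :=
    pow_le_pow_left₀ (norm_nonneg _) ((le_max_left _ _).trans hb.origin) 2
  have hx : x - (fun _ => 0) = x := sub_zero x
  rw [hx] at h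
  have h1 := norm_add_sq_le_two_mul (b (x i) (empirical x) - b 0 (diracP2 0)) (b 0 (diracP2 0))
  rw [sub_add_cancel] at h1
  linarith

/-- Source of all measurability and integrability of the drift. `P2` carries no topology here, so
continuity is expressed on configurations of particles. -/
lemma LipschitzCoefficients.continuous_drift (hb : LipschitzCoefficients L b σ) (i : Fin N) :
    Continuous fun x : Fin N → Vec d => b (x i) (empirical x) := by
  rw [continuous_iff_continuousAt]
  intro x
  rw [ContinuousAt, tendsto_iff_norm_sub_tendsto_zero]
  have h2 : Filter.Tendsto (fun y : Fin N → Vec d => Real.sqrt (2 * L ^ 2 * energy i (y - x)))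
      (nhds x) (nhds 0) := by
    have : Continuous fun y : Fin N → Vec d => Real.sqrt (2 * L ^ 2 * energy i (y - x)) := by
      fun_prop
    simpa [energy] using this.tendsto x
  refine squeeze_zero (fun _ => norm_nonneg _) (fun y => ?_) h2
  exact Real.le_sqrt_of_sq_le (hb.drift_sub_sq_le y x i)

end Drift

/-! ### Cauchy–Schwarz, Grönwall and integrability along step paths -/

section Integral

lemma sq_norm_integral_le {α E : Type*} [MeasurableSpace α] {μ : Measure α} [IsFiniteMeasure μ]
    [NormedAddCommGroup E] [NormedSpace ℝ E] {f : α → E} (hf : Integrable f μ)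
    (hf2 : Integrable (fun a => ‖f a‖ ^ 2) μ) :
    ‖∫ a, f a ∂μ‖ ^ 2 ≤ μ.real univ * ∫ a, ‖f a‖ ^ 2 ∂μ := by
  rcases eq_or_ne μ 0 with rfl | hμ
  · simp
  have hm : 0 < μ.real univ := by
    rw [measureReal_def]
    exact ENNReal.toReal_pos (by simpa using hμ) (measure_ne_top _ _)
  set m := μ.real univ
  set I := ∫ a, ‖f a‖ ∂μ with hI
  -- Cauchy–Schwarz from integrating the square of `m * ‖f a‖ - I`.
  have h0 : 0 ≤ ∫ a, (m ^ 2 * ‖f a‖ ^ 2 - 2 * m * I * ‖f a‖ + I ^ 2) ∂μ :=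
    integral_nonneg fun a => by
      have := sq_nonneg (m * ‖f a‖ - I)
      simp only [Pi.zero_apply]
      linarith
  rw [integral_add (f := fun a => m ^ 2 * ‖f a‖ ^ 2 - 2 * m * I * ‖f a‖)
    ((hf2.const_mul _).sub (hf.norm.const_mul _)) (integrable_const _), integral_sub (hf2.const_mul _) (hf.norm.const_mul _), integral_const_mul, integral_const_mul,
    integral_const, ← hI, smul_eq_mul] at h0
  have h1 : 0 ≤ m * (m * (∫ a, ‖f a‖ ^ 2 ∂μ) - I ^ 2) := by
    change 0 ≤ _ + m * I ^ 2 at h0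
    linarith
  have h2 := nonneg_of_mul_nonneg_right h1 hm
  have h3 := pow_le_pow_left₀ (norm_nonneg _) (norm_integral_le_integral_norm (μ := μ) f) 2
  linarith

/-- Grönwall's inequality in integral form. -/
lemma le_mul_exp_of_le_integral {a : ℝ → ℝ} {T K R : ℝ} (hK : 0 ≤ K)
    (ha : ContinuousOn a (Icc 0 T)) (ha0 : ∀ t ∈ Icc 0 T, 0 ≤ a t) (hR : 0 ≤ R)
    (h : ∀ t ∈ Icc 0 T, a t ≤ R + K * ∫ s in (0 : ℝ)..t, a s) :
    ∀ t ∈ Icc 0 T, a t ≤ R * Real.exp (K * t) := by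
  intro t ht
  have hT : 0 ≤ T := ht.1.trans ht.2
  -- Extending `a` by its end values makes it continuous on the whole line. The right-hand side `U`
  -- is then differentiable everywhere with `U' = K * a' ≤ K * U` on the interval, and the
  -- differential Grönwall inequality applies to `U`.
  set a' : ℝ → ℝ := IccExtend hT ((Icc 0 T).domRestrict a) with ha'
  have hc : Continuous a' := (continuousOn_iff_continuous_domRestrict.1 ha).Icc_extend'
  have heq : ∀ s ∈ Icc 0 T, a' s = a s := fun s hs => by
    simp [ha', IccExtend_of_mem hT _ hs, domRestrict]
  have hint : ∀ s ∈ Icc 0 T, ∫ r in (0 : ℝ)..s, a' r = ∫ r in (0 : ℝ)..s, a r := fun s hs =>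
    intervalIntegral.integral_congr fun r hr => by
      rw [uIcc_of_le hs.1] at hr
      exact heq r ⟨hr.1, hr.2.trans hs.2⟩
  set U : ℝ → ℝ := fun s => R + K * ∫ r in (0 : ℝ)..s, a' r with hU
  have hd : ∀ s, HasDerivAt U (K * a' s) s := fun s =>
    ((intervalIntegral.integral_hasDerivAt_right (hc.intervalIntegrable _ _)
      hc.aestronglyMeasurable.stronglyMeasurableAtFilter hc.continuousAt).const_mul K).const_add R
  have haU : ∀ s ∈ Icc 0 T, a' s ≤ U s := fun s hs => by
    rw [hU]; simp only [hint s hs, heq s hs]; exact h s hs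
  have hg := norm_le_gronwallBound_of_norm_deriv_right_le (f := U) (f' := fun s => K * a' s)
    (δ := R) (K := K) (ε := 0) (a := 0) (b := T)
    (fun s _ => (hd s).continuousAt.continuousWithinAt) (fun s _ => (hd s).hasDerivWithinAt)
    (by simp [hU, abs_of_nonneg hR])
    (fun s hs => by
      have hs' := Ico_subset_Icc_self hs
      have h0 : 0 ≤ a' s := by rw [heq s hs']; exact ha0 s hs'
      rw [add_zero, Real.norm_of_nonneg (mul_nonneg hK h0)]
      exact mul_le_mul_of_nonneg_left ((haU s hs').trans (le_abs_self _)) hK) t ht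
  rw [gronwallBound_ε0, sub_zero] at hg
  rw [← heq t ht]
  exact (haU t ht).trans ((le_abs_self _).trans hg)

/-- A continuous function of a continuous path and of a step path is integrable. -/
lemma integrableOn_comp_prodMk_floor {V W E : Type*} [TopologicalSpace V]
    [TopologicalSpace.PseudoMetrizableSpace V] [SecondCountableTopology V] [TopologicalSpace W]
    [TopologicalSpace.PseudoMetrizableSpace W] [SecondCountableTopology W]
    [NormedAddCommGroup E] {G : V × W → E} (hG : Continuous G) {u : ℝ → V} {T : ℝ}
    (hu : ContinuousOn u (Icc 0 T)) (g : ℕ → W) {Δ : ℝ} (hΔ : 0 < Δ) :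
    IntegrableOn (fun s => G (u s, g ⌊s / Δ⌋₊)) (Icc 0 T) := by
  have hg : StronglyMeasurable fun s : ℝ => g ⌊s / Δ⌋₊ := by
    have h1 : Measurable fun s : ℝ => ⌊s / Δ⌋₊ := by fun_prop
    have h2 : StronglyMeasurable g := StronglyMeasurable.of_discrete
    exact h2.comp_measurable h1
  have hm : AEStronglyMeasurable (fun s => G (u s, g ⌊s / Δ⌋₊)) (volume.restrict (Icc 0 T)) :=
    hG.comp_aestronglyMeasurable
      ((hu.aestronglyMeasurable measurableSet_Icc).prodMk hg.aestronglyMeasurable)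
  -- Up to time `T` only finitely many values of `g` occur, so the argument of `G` stays in a
  -- compact set.
  have hcomp : IsCompact ((u '' Icc 0 T) ×ˢ (g '' Iic ⌊T / Δ⌋₊)) :=
    (isCompact_Icc.image_of_continuousOn hu).prod ((finite_Iic _).image g).isCompact
  obtain ⟨C, hC⟩ := hcomp.exists_bound_of_continuousOn hG.continuousOn
  refine Integrable.of_bound hm C ?_
  refine (ae_restrict_mem measurableSet_Icc).mono fun s hs => hC _ ⟨⟨s, hs, rfl⟩, _, ?_, rfl⟩
  exact Nat.floor_mono (by gcongr; exact hs.2)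

end Integral

/-! ### Time integrals of step functions -/

section Scheme

variable {Δ : ℝ}

lemma floor_div_eq_of_mem_Ico (hΔ : 0 < Δ) {k : ℕ} {s : ℝ} (hs : s ∈ Ico (k * Δ) ((k + 1) * Δ)) :
    ⌊s / Δ⌋₊ = k := by
  have h0 : 0 ≤ s := (by positivity : (0 : ℝ) ≤ k * Δ).trans hs.1
  rw [Nat.floor_eq_iff (by positivity)]
  exact ⟨(le_div_iff₀ hΔ).2 hs.1, (div_lt_iff₀ hΔ).2 hs.2⟩

lemma mem_Ico_floor_div (hΔ : 0 < Δ) {t : ℝ} (ht : 0 ≤ t) :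
    t ∈ Ico (⌊t / Δ⌋₊ * Δ) ((⌊t / Δ⌋₊ + 1) * Δ) :=
  ⟨(le_div_iff₀ hΔ).1 (Nat.floor_le (by positivity)), (div_lt_iff₀ hΔ).1 (Nat.lt_floor_add_one _)⟩

lemma intervalIntegrable_comp_floor {E : Type*} [NormedAddCommGroup E] (hΔ : 0 < Δ) (g : ℕ → E)
    {s t : ℝ} (hs : 0 ≤ s) (hst : s ≤ t) :
    IntervalIntegrable (fun s => g ⌊s / Δ⌋₊) volume s t := by
  have h := integrableOn_comp_prodMk_floor (G := fun p : ℝ × ℕ => g p.2) (T := t) (by fun_prop)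
    continuousOn_id id hΔ
  exact (intervalIntegrable_iff_integrableOn_Icc_of_le hst).2 (h.mono_set (Icc_subset_Icc_left hs))

variable {E : Type*} [NormedAddCommGroup E] [NormedSpace ℝ E] [CompleteSpace E]

lemma integral_comp_floor_of_mem (hΔ : 0 < Δ) (g : ℕ → E) {k : ℕ} {t : ℝ}
    (ht : t ∈ Icc (k * Δ) ((k + 1) * Δ)) :
    ∫ s in (k * Δ)..t, g ⌊s / Δ⌋₊ = (t - k * Δ) • g k := by
  rw [← intervalIntegral.integral_const]
  refine intervalIntegral.integral_congr_ae ?_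
  -- At `t = (k + 1) * Δ` the floor has already jumped to `k + 1`; this single point is null.
  have hne : ∀ᵐ s : ℝ, s ≠ t := by simp [ae_iff]
  filter_upwards [hne] with s hst hs
  rw [uIoc_of_le ht.1] at hs
  rw [floor_div_eq_of_mem_Ico hΔ ⟨hs.1.le, (lt_of_le_of_ne hs.2 hst).trans_le ht.2⟩]

lemma integral_comp_floor_mul (hΔ : 0 < Δ) (g : ℕ → E) (k : ℕ) :
    ∫ s in (0 : ℝ)..(k * Δ), g ⌊s / Δ⌋₊ = Δ • ∑ l ∈ Finset.range k, g l := by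
  induction k with
  | zero => simp
  | succ k ih =>
    have hk : (0 : ℝ) ≤ k * Δ := by positivity
    have hk1 : (k : ℝ) * Δ ≤ (k + 1) * Δ := by gcongr; linarith
    push_cast
    rw [← intervalIntegral.integral_add_adjacent_intervals
      (intervalIntegrable_comp_floor hΔ g le_rfl hk) (intervalIntegrable_comp_floor hΔ g hk hk1),
      ih, integral_comp_floor_of_mem hΔ g ⟨hk1, le_rfl⟩, Finset.sum_range_succ, smul_add]
    congr 2
    ring

end Scheme

/-! ### Summed and integral forms of the scheme -/

section Scheme

variable {d N : ℕ} [NeZero N] {b : Vec d → P2 d → Vec d} {ξ : Matrix (Fin d) (Fin d) ℝ}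
  {x₀ : Fin N → Vec d} {w : Fin N → ℝ → Vec d} {Δ : ℝ}

lemma constIntegral_add (v : ℝ → Vec d) (r s t : ℝ) :
    constIntegral ξ v r s + constIntegral ξ v s t = constIntegral ξ v r t := by
  simp only [constIntegral, ← map_add]
  congr 1
  abel

lemma emNode_succ (k : ℕ) (i : Fin N) :
    emNode b ξ x₀ w Δ (k + 1) i = emNode b ξ x₀ w Δ k i
      + Δ • b (emNode b ξ x₀ w Δ k i) (empirical (emNode b ξ x₀ w Δ k))
      + constIntegral ξ (w i) (k * Δ) ((k + 1) * Δ) := rfl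

lemma emNode_eq_sum (k : ℕ) (i : Fin N) :
    emNode b ξ x₀ w Δ k i = x₀ i + Δ • ∑ l ∈ Finset.range k,
      b (emNode b ξ x₀ w Δ l i) (empirical (emNode b ξ x₀ w Δ l))
      + constIntegral ξ (w i) 0 (k * Δ) := by
  induction k with
  | zero => simp [emNode, constIntegral]
  | succ k ih =>
    have h := constIntegral_add (ξ := ξ) (w i) 0 (k * Δ) ((k + 1) * Δ)
    rw [Finset.sum_range_succ, smul_add, Nat.cast_succ, ← h, emNode_succ]
    nth_rewrite 1 [ih]
    abel

lemma emInterp_eq_emNode_add (hΔ : 0 < Δ) {t : ℝ} (ht : 0 ≤ t) (i : Fin N) :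
    emInterp b ξ x₀ w Δ t i = emStep b ξ x₀ w Δ t i
      + (t - ⌊t / Δ⌋₊ * Δ) • b (emStep b ξ x₀ w Δ t i) (empirical (emStep b ξ x₀ w Δ t))
      + constIntegral ξ (w i) (⌊t / Δ⌋₊ * Δ) t := by
  rw [emInterp]
  have := integral_comp_floor_of_mem hΔ
    (fun k => b (emNode b ξ x₀ w Δ k i) (empirical (emNode b ξ x₀ w Δ k)))
    (Ico_subset_Icc_self (mem_Ico_floor_div hΔ ht))
  simp only [emStep]
  rw [this]

/-- Telescoping over the mesh brings the scheme into the form of the particle equation, with the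
same noise term; this is what makes the noise cancel in the error. -/
lemma emInterp_eq_integral (hΔ : 0 < Δ) {t : ℝ} (ht : 0 ≤ t) (i : Fin N) :
    emInterp b ξ x₀ w Δ t i = x₀ i
      + (∫ s in (0 : ℝ)..t, b (emStep b ξ x₀ w Δ s i) (empirical (emStep b ξ x₀ w Δ s)))
      + constIntegral ξ (w i) 0 t := by
  have hk : (0 : ℝ) ≤ ⌊t / Δ⌋₊ * Δ := by positivity
  have hkt := (mem_Ico_floor_div hΔ ht).1
  set g : ℕ → Vec d := fun k => b (emNode b ξ x₀ w Δ k i) (empirical (emNode b ξ x₀ w Δ k))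
    with hg
  have h1 := integral_comp_floor_mul hΔ g ⌊t / Δ⌋₊
  have h2 := intervalIntegral.integral_add_adjacent_intervals
    (intervalIntegrable_comp_floor hΔ g le_rfl hk) (intervalIntegrable_comp_floor hΔ g hk hkt)
  have h3 := constIntegral_add (ξ := ξ) (w i) 0 (⌊t / Δ⌋₊ * Δ) t
  rw [emInterp, emNode_eq_sum]
  simp only [emStep]
  change _ + Δ • ∑ l ∈ Finset.range ⌊t / Δ⌋₊, g l + _ + (∫ s in _..t, g ⌊s / Δ⌋₊) + _
    = _ + (∫ s in (0 : ℝ)..t, g ⌊s / Δ⌋₊) + _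
  rw [← h1, ← h2, ← h3]
  abel

end Scheme

/-! ### Pathwise stability -/

section Pathwise

variable {d N : ℕ} [NeZero N] {b : Vec d → P2 d → Vec d} {ξ : Matrix (Fin d) (Fin d) ℝ}
  {σ : P2 d → Matrix (Fin d) (Fin d) ℝ} {x₀ : Fin N → Vec d} {w x : Fin N → ℝ → Vec d}
  {Δ T L : ℝ}

/-- The definition by floors hides continuity at the mesh points; the integral form shows it. -/
lemma continuousOn_emInterp (hb : LipschitzCoefficients L b σ) (hΔ : 0 < Δ)
    (hw : ∀ i, ContinuousOn (w i) (Icc 0 T)) :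
    ContinuousOn (emInterp b ξ x₀ w Δ) (Icc 0 T) := by
  rcases lt_or_ge T 0 with hT | hT
  · simp [Icc_eq_empty_of_lt hT]
  refine continuousOn_pi.2 fun i => ContinuousOn.congr ?_
    fun t ht => emInterp_eq_integral hΔ ht.1 i
  refine (continuousOn_const.add ?_).add ?_
  · have h := integrableOn_comp_prodMk_floor
      (G := fun p : ℝ × (Fin N → Vec d) => b (p.2 i) (empirical p.2)) (T := T)
      ((hb.continuous_drift i).comp continuous_snd) continuousOn_id (emNode b ξ x₀ w Δ) hΔ
    rw [← uIcc_of_le hT] at h ⊢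
    exact intervalIntegral.continuousOn_primitive_interval h
  · exact (Matrix.toEuclideanCLM (𝕜 := ℝ) ξ).continuous.comp_continuousOn
      ((hw i).sub continuousOn_const)

lemma integrableOn_energy_emInterp_sub (hb : LipschitzCoefficients L b σ) (hΔ : 0 < Δ)
    (hw : ∀ i, ContinuousOn (w i) (Icc 0 T)) (i : Fin N) :
    IntegrableOn (fun s => energy i (emInterp b ξ x₀ w Δ s - emStep b ξ x₀ w Δ s)) (Icc 0 T) :=
  integrableOn_comp_prodMk_floor
    (G := fun p : (Fin N → Vec d) × (Fin N → Vec d) => energy i (p.1 - p.2)) (by fun_prop)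
    (continuousOn_emInterp hb hΔ hw) (emNode b ξ x₀ w Δ) hΔ

/-- Stability of the equation, path by path: the error of the Euler–Maruyama method is controlled
by the distance of its continuous to its piecewise constant extension. -/
lemma sq_norm_sub_emInterp_le (hb : LipschitzCoefficients L b σ) (hΔ : 0 < Δ)
    (hx : ∀ i, ContinuousOn (x i) (Icc 0 T)) (hw : ∀ i, ContinuousOn (w i) (Icc 0 T))
    (heq : ∀ i, ∀ t ∈ Icc 0 T, x i t = x₀ i
      + (∫ s in (0 : ℝ)..t, b (x i s) (empirical fun j => x j s)) + constIntegral ξ (w i) 0 t)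
    {t : ℝ} (ht : t ∈ Icc 0 T) (i : Fin N) :
    ‖x i t - emInterp b ξ x₀ w Δ t i‖ ^ 2 ≤ 12 * L ^ 2 * T * Real.exp (12 * L ^ 2 * T * T)
      * ∫ s in Icc 0 T, energy i (emInterp b ξ x₀ w Δ s - emStep b ξ x₀ w Δ s) := by
  have hT : 0 ≤ T := ht.1.trans ht.2
  set Y := emInterp b ξ x₀ w Δ with hY
  set S := emStep b ξ x₀ w Δ with hS
  set Z : ℝ → Fin N → Vec d := fun s j => x j s with hZ
  have hYc : ContinuousOn Y (Icc 0 T) := continuousOn_emInterp hb hΔ hw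
  have hZc : ContinuousOn Z (Icc 0 T) := continuousOn_pi.2 hx
  have hZS : ∀ {E : Type} [NormedAddCommGroup E] {G : (Fin N → Vec d) × (Fin N → Vec d) → E},
      Continuous G → IntegrableOn (fun s => G (Z s, S s)) (Icc 0 T) := fun hG =>
    integrableOn_comp_prodMk_floor hG hZc (emNode b ξ x₀ w Δ) hΔ
  have hYS := integrableOn_energy_emInterp_sub (ξ := ξ) (x₀ := x₀) hb hΔ hw
  set R := ∫ s in Icc 0 T, energy i (Y s - S s) with hR
  have hR0 : 0 ≤ R := integral_nonneg fun s => energy_nonneg _ _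
  -- `2 * L ^ 2 * T` from Cauchy–Schwarz and the Lipschitz bound, 3 from `energy_le_integral`, 2
  -- from splitting `Z - S` into `Z - Y` and `Y - S`.
  set K := 12 * L ^ 2 * T with hK
  have hK0 : 0 ≤ K := by positivity
  have herr : ∀ r ∈ Icc 0 T, ∀ j, ‖(Z r - Y r) j‖ ^ 2
      ≤ 2 * L ^ 2 * T * ∫ s in Icc 0 r, energy j (Z s - S s) := by
    intro r hr j
    have hsub : Icc 0 r ⊆ Icc 0 T := Icc_subset_Icc_right hr.2
    have hc := hb.continuous_drift (N := N) j
    have hD : IntegrableOn (fun s => b (Z s j) (empirical (Z s)) - b (S s j) (empirical (S s)))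
        (Icc 0 T) :=
      hZS (G := fun p => b (p.1 j) (empirical p.1) - b (p.2 j) (empirical p.2))
        ((hc.comp continuous_fst).sub (hc.comp continuous_snd))
    have hD2 : IntegrableOn
        (fun s => ‖b (Z s j) (empirical (Z s)) - b (S s j) (empirical (S s))‖ ^ 2) (Icc 0 T) :=
      hZS (G := fun p => ‖b (p.1 j) (empirical p.1) - b (p.2 j) (empirical p.2)‖ ^ 2)
        (((hc.comp continuous_fst).sub (hc.comp continuous_snd)).norm.pow 2)
    have hDE : IntegrableOn (fun s => energy j (Z s - S s)) (Icc 0 T) :=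
      hZS (G := fun p => energy j (p.1 - p.2)) (by fun_prop)
    have hi1 : IntegrableOn (fun s => b (Z s j) (empirical (Z s))) (Icc 0 T) :=
      hZS (G := fun p => b (p.1 j) (empirical p.1)) (hc.comp continuous_fst)
    have hi2 : IntegrableOn (fun s => b (S s j) (empirical (S s))) (Icc 0 T) :=
      hZS (G := fun p => b (p.2 j) (empirical p.2)) (hc.comp continuous_snd)
    -- Initial values and noise terms cancel here.
    have he : (Z r - Y r) j
        = ∫ s in Icc 0 r, (b (Z s j) (empirical (Z s)) - b (S s j) (empirical (S s))) := by
      rw [integral_sub (hi1.mono_set hsub) (hi2.mono_set hsub), integral_Icc_eq_integral_Ioc,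
        integral_Icc_eq_integral_Ioc, ← intervalIntegral.integral_of_le hr.1,
        ← intervalIntegral.integral_of_le hr.1, Pi.sub_apply, hY, emInterp_eq_integral hΔ hr.1 j]
      simp only [hZ]
      rw [heq j r hr]
      abel
    rw [he]
    refine (sq_norm_integral_le (hD.mono_set hsub) (hD2.mono_set hsub)).trans ?_
    have hvol : (volume.restrict (Icc 0 r)).real univ = r := by
      simp [measureReal_restrict_apply, hr.1]
    rw [hvol]
    calc r * ∫ s in Icc 0 r, ‖b (Z s j) (empirical (Z s)) - b (S s j) (empirical (S s))‖ ^ 2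
        ≤ T * ∫ s in Icc 0 r, 2 * L ^ 2 * energy j (Z s - S s) := by
          refine mul_le_mul hr.2 ?_ (integral_nonneg fun s => by positivity) hT
          exact integral_mono (hD2.mono_set hsub) ((hDE.mono_set hsub).const_mul _)
            fun s => hb.drift_sub_sq_le (Z s) (S s) j
      _ = _ := by rw [integral_const_mul]; ring
  have hcont : ContinuousOn (fun s => energy i (Z s - Y s)) (Icc 0 T) :=
    (continuous_energy i).comp_continuousOn (hZc.sub hYc)
  have hgron : ∀ r ∈ Icc 0 T, energy i (Z r - Y r)
      ≤ K * R + K * ∫ s in (0 : ℝ)..r, energy i (Z s - Y s) := by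
    intro r hr
    have hsub : Icc 0 r ⊆ Icc 0 T := Icc_subset_Icc_right hr.2
    have hDE : ∀ j, IntegrableOn (fun s => energy j (Z s - S s)) (Icc 0 r) := fun j =>
      (hZS (G := fun p => energy j (p.1 - p.2)) (by fun_prop)).mono_set hsub
    have hI1 : IntegrableOn (fun s => energy i (Z s - Y s)) (Icc 0 r) :=
      (hcont.mono hsub).integrableOn_Icc
    have h1 := energy_le_integral (by positivity) hDE (herr r hr) i
    have h2 : ∫ s in Icc 0 r, energy i (Z s - S s)
        ≤ ∫ s in Icc 0 r, (2 * energy i (Z s - Y s) + 2 * energy i (Y s - S s)) :=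
      integral_mono (hDE i) ((hI1.const_mul 2).add (((hYS i).mono_set hsub).const_mul 2))
        fun s => by
          have := energy_add_le i (Z s - Y s) (Y s - S s)
          rwa [sub_add_sub_cancel] at this
    rw [integral_add (hI1.const_mul 2) (((hYS i).mono_set hsub).const_mul 2), integral_const_mul,
      integral_const_mul] at h2
    have h3 : ∫ s in Icc 0 r, energy i (Y s - S s) ≤ R :=
      setIntegral_mono_set (hYS i) (.of_forall fun s => energy_nonneg _ _) hsub.eventuallyLE
    rw [intervalIntegral.integral_of_le hr.1, ← integral_Icc_eq_integral_Ioc]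
    have h4 : energy i (Z r - Y r) ≤ 3 * (2 * L ^ 2 * T) *
        (2 * (∫ s in Icc 0 r, energy i (Z s - Y s)) + 2 * R) :=
      h1.trans (mul_le_mul_of_nonneg_left (by linarith) (by positivity))
    linarith
  have hfin := le_mul_exp_of_le_integral hK0 hcont (fun s _ => energy_nonneg _ _)
    (mul_nonneg hK0 hR0) hgron t ht
  calc ‖x i t - Y t i‖ ^ 2 ≤ energy i (Z t - Y t) := norm_sq_le_energy i (Z t - Y t)
    _ ≤ K * R * Real.exp (K * t) := hfin
    _ ≤ K * R * Real.exp (K * T) := by gcongr; exact ht.2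
    _ = _ := by ring

end Pathwise

/-! ### Second moments of fractional increments -/

section FBM

variable {d : ℕ} {Ω : Type*} [MeasurableSpace Ω] {P : Measure Ω} {H T : ℝ} {B : ℝ → Ω → Vec d}

lemma hsNorm_sq (A : Matrix (Fin d) (Fin d) ℝ) : hsNorm A ^ 2 = ∑ i, ∑ j, A i j ^ 2 :=
  Real.sq_sqrt (by positivity)

lemma IsFBM.memLp (hB : IsFBM P H T B) {t : ℝ} (ht : t ∈ Icc 0 T) : MemLp (B t) 2 P :=
  (hB.gaussian.hasGaussianLaw_eval ⟨t, ht⟩).memLp_two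

lemma IsFBM.memLp_coord (hB : IsFBM P H T B) {t : ℝ} (ht : t ∈ Icc 0 T) (k : Fin d) :
    MemLp (fun ω => B t ω k) 2 P :=
  (EuclideanSpace.proj (𝕜 := ℝ) k).comp_memLp' (hB.memLp ht)

lemma IsFBM.integrable_increment_mul (hB : IsFBM P H T B) {s t : ℝ} (hs : s ∈ Icc 0 T)
    (ht : t ∈ Icc 0 T) (k l : Fin d) :
    Integrable (fun ω => (B t ω k - B s ω k) * (B t ω l - B s ω l)) P :=
  ((hB.memLp_coord ht k).sub (hB.memLp_coord hs k)).integrable_mul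
    ((hB.memLp_coord ht l).sub (hB.memLp_coord hs l))

lemma IsFBM.integral_increment_mul (hB : IsFBM P H T B) (hH : 0 < H) {s t : ℝ} (hs : s ∈ Icc 0 T)
    (ht : t ∈ Icc 0 T) (k l : Fin d) :
    ∫ ω, (B t ω k - B s ω k) * (B t ω l - B s ω l) ∂P
      = if k = l then |t - s| ^ (2 * H) else 0 := by
  have hi : ∀ r ∈ Icc 0 T, ∀ q ∈ Icc 0 T, Integrable (fun ω => B r ω k * B q ω l) P :=
    fun r hr q hq => (hB.memLp_coord hr k).integrable_mul (hB.memLp_coord hq l)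
  have h1 : ∀ ω, (B t ω k - B s ω k) * (B t ω l - B s ω l)
      = (B t ω k * B t ω l - B t ω k * B s ω l) - (B s ω k * B t ω l - B s ω k * B s ω l) :=
    fun ω => by ring
  simp only [h1]
  rw [integral_sub (f := fun ω => B t ω k * B t ω l - B t ω k * B s ω l)
      (g := fun ω => B s ω k * B t ω l - B s ω k * B s ω l)
      ((hi t ht t ht).sub (hi t ht s hs)) ((hi s hs t ht).sub (hi s hs s hs)),
    integral_sub (hi t ht t ht) (hi t ht s hs), integral_sub (hi s hs t ht) (hi s hs s hs),
    hB.covariance t ht t ht, hB.covariance t ht s hs, hB.covariance s hs t ht,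
    hB.covariance s hs s hs]
  split_ifs
  -- Positivity of `H` matters: `fbmCov H t t` contains `0 ^ (2 * H)`, and `0 ^ 0 = 1`.
  · have h0 : (0 : ℝ) ^ (2 * H) = 0 := Real.zero_rpow (by positivity)
    simp only [fbmCov, sub_self, abs_zero, h0, abs_sub_comm s t]
    ring
  · simp

lemma sq_norm_constIntegral (ξ : Matrix (Fin d) (Fin d) ℝ) (v : ℝ → Vec d) (s t : ℝ) :
    ‖constIntegral ξ v s t‖ ^ 2
      = ∑ i, ∑ k, ∑ l, ξ i k * ξ i l * ((v t k - v s k) * (v t l - v s l)) := by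
  rw [EuclideanSpace.real_norm_sq_eq]
  refine Finset.sum_congr rfl fun i _ => ?_
  have : constIntegral ξ v s t i = ∑ k, ξ i k * (v t k - v s k) := by
    simp [constIntegral, Matrix.ofLp_toEuclideanCLM, Matrix.mulVec, dotProduct, mul_sub]
  rw [this, sq, Finset.sum_mul_sum]
  refine Finset.sum_congr rfl fun k _ => Finset.sum_congr rfl fun l _ => ?_
  ring

lemma IsFBM.memLp_constIntegral (hB : IsFBM P H T B) (ξ : Matrix (Fin d) (Fin d) ℝ) {s t : ℝ}
    (hs : s ∈ Icc 0 T) (ht : t ∈ Icc 0 T) :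
    MemLp (fun ω => constIntegral ξ (fun r => B r ω) s t) 2 P :=
  (Matrix.toEuclideanCLM (𝕜 := ℝ) ξ).comp_memLp' ((hB.memLp ht).sub (hB.memLp hs))

/-- Distinct coordinates are uncorrelated, so only the squared entries of `ξ` survive in the
quadratic form. -/
lemma IsFBM.integral_sq_norm_constIntegral (hB : IsFBM P H T B) (hH : 0 < H)
    (ξ : Matrix (Fin d) (Fin d) ℝ) {s t : ℝ} (hs : s ∈ Icc 0 T) (ht : t ∈ Icc 0 T) :
    ∫ ω, ‖constIntegral ξ (fun r => B r ω) s t‖ ^ 2 ∂P = hsNorm ξ ^ 2 * |t - s| ^ (2 * H) := by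
  have hi := hB.integrable_increment_mul hs ht
  simp only [sq_norm_constIntegral]
  rw [integral_finsetSum _ fun i _ => integrable_finsetSum _ fun k _ =>
    integrable_finsetSum _ fun l _ => (hi k l).const_mul _, hsNorm_sq, Finset.sum_mul]
  refine Finset.sum_congr rfl fun i _ => ?_
  rw [integral_finsetSum _ fun k _ => integrable_finsetSum _ fun l _ => (hi k l).const_mul _,
    Finset.sum_mul]
  refine Finset.sum_congr rfl fun k _ => ?_
  rw [integral_finsetSum _ fun l _ => (hi k l).const_mul _]
  simp only [integral_const_mul, hB.integral_increment_mul hH hs ht]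
  simp [sq]

end FBM

/-! ### Joint measurability in time and chance -/

section Measurability

variable {Ω E : Type*} [MeasurableSpace Ω] [Nonempty E] [MeasurableSpace E] {P : Measure Ω}

/-- A process sampled at countably many times is jointly measurable. -/
lemma aemeasurable_comp_nat {α : Type*} [MeasurableSpace α] {μ : Measure α} [SFinite μ]
    {Z : ℕ → Ω → E} {φ : α → ℕ} (hφ : Measurable φ) (hm : ∀ᵐ a ∂μ, AEMeasurable (Z (φ a)) P) :
    AEMeasurable (fun p : α × Ω => Z (φ p.1) p.2) (μ.prod P) := by
  classical
  -- Indices at which `Z` is not known to be measurable, such as mesh times beyond `T`, get a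
  -- constant; `φ` almost never takes them.
  set A : ℕ → Ω → E := fun k => if h : AEMeasurable (Z k) P then h.mk _
    else fun _ => Classical.arbitrary E with hA
  have hAm : ∀ k, Measurable (A k) := fun k => by
    simp only [hA]
    split_ifs with h
    · exact h.measurable_mk
    · exact measurable_const
  refine ⟨fun p => A (φ p.1) p.2, ?_, ?_⟩
  · have h1 : Measurable (Function.uncurry A) := measurable_from_prod_countable_right hAm
    exact h1.comp ((hφ.comp measurable_fst).prodMk measurable_snd)
  · have h1 : ∀ᵐ ω ∂P, ∀ k, AEMeasurable (Z k) P → Z k ω = A k ω := by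
      rw [ae_all_iff]
      intro k
      by_cases h : AEMeasurable (Z k) P
      · filter_upwards [h.ae_eq_mk] with ω hω _
        simp [hA, h, hω]
      · exact .of_forall fun ω h' => absurd h' h
    filter_upwards [Measure.quasiMeasurePreserving_fst.ae hm,
      Measure.quasiMeasurePreserving_snd.ae h1] with p hp1 hp2
    exact hp2 _ hp1

variable [TopologicalSpace E] [TopologicalSpace.PseudoMetrizableSpace E] [BorelSpace E]

/-- A process with almost surely continuous paths is jointly measurable. -/
lemma aemeasurable_uncurry_of_continuousOn {Z : ℝ → Ω → E} {T : ℝ}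
    (hm : ∀ t ∈ Icc 0 T, AEMeasurable (Z t) P)
    (hc : ∀ᵐ ω ∂P, ContinuousOn (fun t => Z t ω) (Icc 0 T)) :
    AEMeasurable (Function.uncurry Z) ((volume.restrict (Icc 0 T)).prod P) := by
  -- Grid points to the left of `s`: they stay in `[0, T]` and converge to `s`, so continuous paths
  -- are limits of sampled ones.
  set q : ℕ → ℝ → ℝ := fun n s => ⌊s * (n + 1 : ℝ)⌋₊ / (n + 1 : ℝ) with hq
  have hq0 : ∀ n s, 0 ≤ q n s := fun n s => by positivity
  have hqs : ∀ n s, 0 ≤ s → q n s ≤ s := fun n s hs => by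
    have hn : (0 : ℝ) < n + 1 := by positivity
    exact (div_le_iff₀ hn).2 (Nat.floor_le (by positivity))
  have hqt : ∀ s, 0 ≤ s → Filter.Tendsto (fun n => q n s) Filter.atTop (nhds s) := fun s hs => by
    have h1 := tendsto_one_div_add_atTop_nhds_zero_nat (𝕜 := ℝ)
    refine tendsto_of_tendsto_of_tendsto_of_le_of_le (g := fun n : ℕ => s - 1 / ((n : ℝ) + 1))
      (by simpa using h1.const_sub s) tendsto_const_nhds (fun n => ?_) fun n => hqs n s hs
    have hn : (0 : ℝ) < n + 1 := by positivity
    have := Nat.lt_floor_add_one (s * (n + 1 : ℝ))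
    simp only [hq]
    rw [sub_le_iff_le_add, ← add_div, le_div_iff₀ hn]
    exact this.le
  refine aemeasurable_of_tendsto_metrizable_ae (u := Filter.atTop)
    (f := fun n p => Z (q n p.1) p.2) (fun n => ?_) ?_
  · refine aemeasurable_comp_nat (Z := fun k => Z (k / (n + 1 : ℝ)))
      (φ := fun s : ℝ => ⌊s * (n + 1 : ℝ)⌋₊) (by fun_prop) ?_
    filter_upwards [ae_restrict_mem measurableSet_Icc] with s hs
    exact hm _ ⟨hq0 n s, (hqs n s hs.1).trans hs.2⟩
  · filter_upwards [Measure.quasiMeasurePreserving_fst.ae (ae_restrict_mem measurableSet_Icc),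
      Measure.quasiMeasurePreserving_snd.ae hc] with p hp1 hp2
    refine (hp2 p.1 hp1).tendsto.comp (tendsto_nhdsWithin_iff.2 ⟨hqt p.1 hp1.1, ?_⟩)
    exact .of_forall fun n => ⟨hq0 n _, (hqs n _ hp1.1).trans hp1.2⟩

end Measurability

/-! ### Second moments of energy and drift -/

section Moments

variable {d N : ℕ} {Ω : Type*} [MeasurableSpace Ω] {P : Measure Ω}
  {z : Ω → Fin N → Vec d}

lemma norm_add₃_sq_le {E : Type*} [SeminormedAddCommGroup E] (u v w : E) :
    ‖u + v + w‖ ^ 2 ≤ 3 * ‖u‖ ^ 2 + 3 * ‖v‖ ^ 2 + 3 * ‖w‖ ^ 2 := by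
  have h := pow_le_pow_left₀ (norm_nonneg _) (norm_add₃_le (a := u) (b := v) (c := w)) 2
  nlinarith [sq_nonneg (‖u‖ - ‖v‖), sq_nonneg (‖v‖ - ‖w‖), sq_nonneg (‖u‖ - ‖w‖)]

lemma norm_sum_sq_le {ι E : Type*} [SeminormedAddCommGroup E] (s : Finset ι) (v : ι → E) :
    ‖∑ l ∈ s, v l‖ ^ 2 ≤ s.card * ∑ l ∈ s, ‖v l‖ ^ 2 :=
  (pow_le_pow_left₀ (norm_nonneg _) (norm_sum_le _ _) 2).trans sq_sum_le_card_mul_sum_sq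

lemma aemeasurable_pi_of_memLp (hz : ∀ j, MemLp (fun ω => z ω j) 2 P) : AEMeasurable z P :=
  aemeasurable_pi_lambda _ fun j => (hz j).aestronglyMeasurable.aemeasurable

lemma integrable_sq_norm {E : Type*} [NormedAddCommGroup E] {f : Ω → E} (hf : MemLp f 2 P) :
    Integrable (fun ω => ‖f ω‖ ^ 2) P :=
  (memLp_two_iff_integrable_sq_norm hf.1).1 hf

lemma integrable_energy (hz : ∀ j, MemLp (fun ω => z ω j) 2 P) (i : Fin N) :
    Integrable (fun ω => energy i (z ω)) P :=
  (integrable_sq_norm (hz i)).add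
    ((integrable_finsetSum _ fun j _ => integrable_sq_norm (hz j)).const_mul _)

lemma integral_energy_le [NeZero N] (hz : ∀ j, MemLp (fun ω => z ω j) 2 P) {D : ℝ}
    (hD : ∀ j, ∫ ω, ‖z ω j‖ ^ 2 ∂P ≤ D) (i : Fin N) : ∫ ω, energy i (z ω) ∂P ≤ 2 * D := by
  have hi := fun j => integrable_sq_norm (hz j)
  unfold energy
  rw [integral_add (hi i) ((integrable_finsetSum _ fun j _ => hi j).const_mul _),
    integral_const_mul, integral_finsetSum _ fun j _ => hi j]
  have h := mul_le_mul_of_nonneg_left (Finset.sum_le_sum fun j (_ : j ∈ Finset.univ) => hD j)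
    (inv_nonneg.2 (Nat.cast_nonneg (α := ℝ) N))
  rw [mean_const] at h
  linarith [hD i]

variable {L : ℝ} {b : Vec d → P2 d → Vec d} {σ : P2 d → Matrix (Fin d) (Fin d) ℝ}
  [IsProbabilityMeasure P]

lemma LipschitzCoefficients.memLp_drift [NeZero N] (hb : LipschitzCoefficients L b σ)
    (hz : ∀ j, MemLp (fun ω => z ω j) 2 P) (i : Fin N) :
    MemLp (fun ω => b (z ω i) (empirical (z ω))) 2 P := by
  have hm : AEStronglyMeasurable (fun ω => b (z ω i) (empirical (z ω))) P :=
    (hb.continuous_drift i).comp_aestronglyMeasurable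
      (aemeasurable_pi_of_memLp hz).aestronglyMeasurable
  refine (memLp_two_iff_integrable_sq_norm hm).2 ?_
  refine ((integrable_const (2 * L ^ 2)).add ((integrable_energy hz i).const_mul (4 * L ^ 2))).mono'
    (hm.norm.pow 2) (.of_forall fun ω => ?_)
  rw [Real.norm_of_nonneg (by positivity)]
  exact hb.drift_sq_le (z ω) i

lemma LipschitzCoefficients.integral_drift_le [NeZero N] (hb : LipschitzCoefficients L b σ)
    (hz : ∀ j, MemLp (fun ω => z ω j) 2 P) {D : ℝ} (hD : ∀ j, ∫ ω, ‖z ω j‖ ^ 2 ∂P ≤ D)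
    (i : Fin N) : ∫ ω, ‖b (z ω i) (empirical (z ω))‖ ^ 2 ∂P ≤ 2 * L ^ 2 + 8 * L ^ 2 * D := by
  have hE := (integrable_energy hz i).const_mul (4 * L ^ 2)
  have h := integral_mono (integrable_sq_norm (hb.memLp_drift hz i))
    ((integrable_const (2 * L ^ 2)).add hE) fun ω => hb.drift_sq_le (z ω) i
  simp only [Pi.add_apply] at h
  rw [integral_add (integrable_const _) hE, integral_const, integral_const_mul] at h
  have h2 := mul_le_mul_of_nonneg_left (integral_energy_le hz hD i)
    (by positivity : 0 ≤ 4 * L ^ 2)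
  simp only [probReal_univ, one_smul] at h
  linarith

end Moments

/-! ### Mean square estimates for the scheme -/

section Scheme

variable {d N : ℕ} [NeZero N] {Ω : Type*} [MeasurableSpace Ω] {P : Measure Ω}
  [IsProbabilityMeasure P] {L H T Δ m : ℝ} {b : Vec d → P2 d → Vec d}
  {ξ : Matrix (Fin d) (Fin d) ℝ} {X₀ : Fin N → Ω → Vec d} {B : Fin N → ℝ → Ω → Vec d}

lemma LipschitzCoefficients.hsNorm_sq_le (hb : LipschitzCoefficients L b fun _ => ξ) :
    hsNorm ξ ^ 2 ≤ L ^ 2 :=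
  pow_le_pow_left₀ (Real.sqrt_nonneg _) ((le_max_right _ _).trans hb.origin) 2

lemma memLp_emNode (hb : LipschitzCoefficients L b fun _ => ξ) (hX₀ : ∀ i, MemLp (X₀ i) 2 P)
    (hB : ∀ i, IsFBM P H T (B i)) (hΔ : 0 < Δ) (k : ℕ) (hk : k * Δ ≤ T) (i : Fin N) :
    MemLp (fun ω => emNode b ξ (fun j => X₀ j ω) (fun j s => B j s ω) Δ k i) 2 P := by
  induction k generalizing i with
  | zero => exact hX₀ i
  | succ k ih =>
    have hk' : (k : ℝ) * Δ ≤ (k + 1) * Δ := by gcongr; linarith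
    rw [Nat.cast_succ] at hk
    have ih' := ih (hk'.trans hk)
    exact ((ih' i).add ((hb.memLp_drift ih' i).const_smul Δ)).add
      ((hB i).memLp_constIntegral ξ ⟨by positivity, hk'.trans hk⟩ ⟨by positivity, hk⟩)

/-- The second moments of the Euler–Maruyama method grow at most geometrically. -/
lemma integral_sq_emNode_le (hb : LipschitzCoefficients L b fun _ => ξ)
    (hX₀ : ∀ i, MemLp (X₀ i) 2 P) (hm : ∀ i, ∫ ω, ‖X₀ i ω‖ ^ 2 ∂P ≤ m)
    (hB : ∀ i, IsFBM P H T (B i)) (hH : 0 < H) (hT : 0 ≤ T) (hΔ : 0 < Δ) (k : ℕ)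
    (hk : k * Δ ≤ T) (i : Fin N) :
    ∫ ω, ‖emNode b ξ (fun j => X₀ j ω) (fun j s => B j s ω) Δ k i‖ ^ 2 ∂P
      ≤ (3 * m + 3 * L ^ 2 * T ^ (2 * H) + 6 * T ^ 2 * L ^ 2) * (1 + 24 * T * L ^ 2 * Δ) ^ k := by
  -- The three terms bound the initial value, the noise and the constant part of the drift, each
  -- with the factor 3 from squaring a sum of three.
  set c := 3 * m + 3 * L ^ 2 * T ^ (2 * H) + 6 * T ^ 2 * L ^ 2 with hc
  induction k using Nat.strong_induction_on generalizing i with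
  | _ k ih =>
  set β : ℕ → Ω → Vec d := fun l ω =>
    b (emNode b ξ (fun j => X₀ j ω) (fun j s => B j s ω) Δ l i)
      (empirical (emNode b ξ (fun j => X₀ j ω) (fun j s => B j s ω) Δ l)) with hβ
  set ζ : Ω → Vec d := fun ω => constIntegral ξ (fun s => B i s ω) 0 (k * Δ) with hζ
  have hlT : ∀ l ∈ Finset.range k, (l : ℝ) * Δ ≤ T := fun l hl =>
    le_trans (by gcongr; exact (Finset.mem_range.1 hl).le) hk
  have hk0 : (0 : ℝ) ≤ k * Δ := by positivity
  have hβm : ∀ l ∈ Finset.range k, Integrable (fun ω => ‖β l ω‖ ^ 2) P := fun l hl =>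
    integrable_sq_norm (hb.memLp_drift (memLp_emNode hb hX₀ hB hΔ l (hlT l hl)) i)
  have hβi : ∀ l ∈ Finset.range k, ∫ ω, ‖β l ω‖ ^ 2 ∂P
      ≤ 2 * L ^ 2 + 8 * L ^ 2 * (c * (1 + 24 * T * L ^ 2 * Δ) ^ l) := fun l hl =>
    hb.integral_drift_le (memLp_emNode hb hX₀ hB hΔ l (hlT l hl))
      (fun j => ih l (Finset.mem_range.1 hl) (hlT l hl) j) i
  have hζm : MemLp ζ 2 P := (hB i).memLp_constIntegral ξ ⟨le_rfl, hT⟩ ⟨hk0, hk⟩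
  have hζi : ∫ ω, ‖ζ ω‖ ^ 2 ∂P ≤ L ^ 2 * T ^ (2 * H) := by
    rw [(hB i).integral_sq_norm_constIntegral hH ξ ⟨le_rfl, hT⟩ ⟨hk0, hk⟩, sub_zero,
      abs_of_nonneg hk0]
    exact mul_le_mul hb.hsNorm_sq_le (Real.rpow_le_rpow hk0 hk (by positivity)) (by positivity)
      (by positivity)
  have hpath : ∀ ω, ‖emNode b ξ (fun j => X₀ j ω) (fun j s => B j s ω) Δ k i‖ ^ 2
      ≤ 3 * ‖X₀ i ω‖ ^ 2 + 3 * (T * Δ) * (∑ l ∈ Finset.range k, ‖β l ω‖ ^ 2)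
        + 3 * ‖ζ ω‖ ^ 2 := by
    intro ω
    -- The noise enters as one increment from `0` to `k * Δ`, of variance bounded independently of
    -- the mesh. The price is a sum over all earlier nodes, hence strong induction.
    rw [emNode_eq_sum]
    refine (norm_add₃_sq_le _ _ _).trans ?_
    have h1 := norm_sum_sq_le (Finset.range k) (fun l => β l ω)
    rw [Finset.card_range] at h1
    have h2 : ‖Δ • ∑ l ∈ Finset.range k, β l ω‖ ^ 2
        ≤ T * Δ * ∑ l ∈ Finset.range k, ‖β l ω‖ ^ 2 := by
      rw [norm_smul, mul_pow, Real.norm_of_nonneg hΔ.le]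
      calc Δ ^ 2 * ‖∑ l ∈ Finset.range k, β l ω‖ ^ 2
          ≤ Δ ^ 2 * (k * ∑ l ∈ Finset.range k, ‖β l ω‖ ^ 2) := by gcongr
        _ = (k * Δ) * Δ * ∑ l ∈ Finset.range k, ‖β l ω‖ ^ 2 := by ring
        _ ≤ _ := by gcongr
    simp only [hβ] at h2
    simp only [hβ, hζ]
    linarith
  have hsum := integrable_finsetSum (Finset.range k) hβm
  have h := integral_mono (integrable_sq_norm (memLp_emNode hb hX₀ hB hΔ k hk i))
    ((((integrable_sq_norm (hX₀ i)).const_mul 3).add (hsum.const_mul (3 * (T * Δ)))).add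
      ((integrable_sq_norm hζm).const_mul 3)) hpath
  refine h.trans ?_
  simp only [Pi.add_apply]
  rw [integral_add (f := fun ω => 3 * ‖X₀ i ω‖ ^ 2
        + 3 * (T * Δ) * (∑ l ∈ Finset.range k, ‖β l ω‖ ^ 2))
      (((integrable_sq_norm (hX₀ i)).const_mul 3).add (hsum.const_mul _))
      ((integrable_sq_norm hζm).const_mul 3),
    integral_add ((integrable_sq_norm (hX₀ i)).const_mul 3) (hsum.const_mul _),
    integral_const_mul, integral_const_mul, integral_const_mul, integral_finsetSum _ hβm]
  have hs := mul_le_mul_of_nonneg_left (Finset.sum_le_sum hβi) (by positivity : 0 ≤ 3 * (T * Δ))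
  rw [Finset.sum_add_distrib, Finset.sum_const, Finset.card_range, nsmul_eq_mul,
    ← Finset.mul_sum, ← Finset.mul_sum] at hs
  -- With `q = 1 + 24 * T * L ^ 2 * Δ`, the earlier nodes contribute `c * (q - 1) * ∑ q ^ l = c * (q
  -- ^ k - 1)`, which the remaining terms, at most `c`, complete to `c * q ^ k`.
  have hgeom := geom_sum_mul (1 + 24 * T * L ^ 2 * Δ) k
  have hlin : T * L ^ 2 * (k * Δ) ≤ T * L ^ 2 * T := by gcongr
  have hmi := hm i
  have hcg : c * ((∑ l ∈ Finset.range k, (1 + 24 * T * L ^ 2 * Δ) ^ l) * (24 * T * L ^ 2 * Δ))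
      = c * ((1 + 24 * T * L ^ 2 * Δ) ^ k - 1) := by
    rw [← hgeom]; ring
  nlinarith [hs, hcg, hlin, hmi, hζi]

lemma floor_div_mul_le (hΔ : 0 < Δ) {t : ℝ} (ht : t ∈ Icc 0 T) : ⌊t / Δ⌋₊ * Δ ≤ T :=
  (mem_Ico_floor_div hΔ ht.1).1.trans ht.2

lemma memLp_emStep (hb : LipschitzCoefficients L b fun _ => ξ) (hX₀ : ∀ i, MemLp (X₀ i) 2 P)
    (hB : ∀ i, IsFBM P H T (B i)) (hΔ : 0 < Δ) {t : ℝ} (ht : t ∈ Icc 0 T) (i : Fin N) :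
    MemLp (fun ω => emStep b ξ (fun j => X₀ j ω) (fun j s => B j s ω) Δ t i) 2 P :=
  memLp_emNode hb hX₀ hB hΔ _ (floor_div_mul_le hΔ ht) i

lemma memLp_emInterp (hb : LipschitzCoefficients L b fun _ => ξ) (hX₀ : ∀ i, MemLp (X₀ i) 2 P)
    (hB : ∀ i, IsFBM P H T (B i)) (hΔ : 0 < Δ) {t : ℝ} (ht : t ∈ Icc 0 T) (i : Fin N) :
    MemLp (fun ω => emInterp b ξ (fun j => X₀ j ω) (fun j s => B j s ω) Δ t i) 2 P := by
  have h := memLp_emStep hb hX₀ hB hΔ ht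
  have hζ := (hB i).memLp_constIntegral ξ (s := ⌊t / Δ⌋₊ * Δ)
    ⟨by positivity, floor_div_mul_le hΔ ht⟩ ht
  have hsum := ((h i).add ((hb.memLp_drift h i).const_smul (t - ⌊t / Δ⌋₊ * Δ))).add hζ
  refine hsum.ae_eq (.of_forall fun ω => ?_)
  exact (emInterp_eq_emNode_add (x₀ := fun j => X₀ j ω) (w := fun j s => B j s ω) hΔ ht.1 i).symm

/-- The distance of the continuous to the piecewise constant extension in mean square. -/
lemma integral_sq_emInterp_sub_emStep_le (hb : LipschitzCoefficients L b fun _ => ξ)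
    (hX₀ : ∀ i, MemLp (X₀ i) 2 P) (hB : ∀ i, IsFBM P H T (B i)) (hH : 0 < H) (hΔ : 0 < Δ)
    {t : ℝ} (ht : t ∈ Icc 0 T) {D : ℝ}
    (hD : ∀ i, ∫ ω, ‖emStep b ξ (fun j => X₀ j ω) (fun j s => B j s ω) Δ t i‖ ^ 2 ∂P ≤ D)
    (i : Fin N) :
    ∫ ω, ‖emInterp b ξ (fun j => X₀ j ω) (fun j s => B j s ω) Δ t i
        - emStep b ξ (fun j => X₀ j ω) (fun j s => B j s ω) Δ t i‖ ^ 2 ∂P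
      ≤ 2 * Δ ^ 2 * (2 * L ^ 2 + 8 * L ^ 2 * D) + 2 * L ^ 2 * Δ ^ (2 * H) := by
  have h := memLp_emStep hb hX₀ hB hΔ ht
  obtain ⟨hk1, hk2⟩ := mem_Ico_floor_div hΔ ht.1
  have hk0 : ⌊t / Δ⌋₊ * Δ ∈ Icc 0 T := ⟨by positivity, floor_div_mul_le hΔ ht⟩
  have hst : 0 ≤ t - ⌊t / Δ⌋₊ * Δ := by linarith
  have hst' : t - ⌊t / Δ⌋₊ * Δ ≤ Δ := by linarith
  have hζ := (hB i).memLp_constIntegral ξ hk0 ht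
  have hζi : ∫ ω, ‖constIntegral ξ (fun s => B i s ω) (⌊t / Δ⌋₊ * Δ) t‖ ^ 2 ∂P
      ≤ L ^ 2 * Δ ^ (2 * H) := by
    rw [(hB i).integral_sq_norm_constIntegral hH ξ hk0 ht, abs_of_nonneg hst]
    exact mul_le_mul hb.hsNorm_sq_le (Real.rpow_le_rpow hst hst' (by positivity)) (by positivity)
      (by positivity)
  have hβ := hb.memLp_drift h i
  have hβi := hb.integral_drift_le h hD i
  have hpath : ∀ ω, ‖emInterp b ξ (fun j => X₀ j ω) (fun j s => B j s ω) Δ t i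
        - emStep b ξ (fun j => X₀ j ω) (fun j s => B j s ω) Δ t i‖ ^ 2
      ≤ 2 * Δ ^ 2 * ‖b (emStep b ξ (fun j => X₀ j ω) (fun j s => B j s ω) Δ t i)
          (empirical (emStep b ξ (fun j => X₀ j ω) (fun j s => B j s ω) Δ t))‖ ^ 2
        + 2 * ‖constIntegral ξ (fun s => B i s ω) (⌊t / Δ⌋₊ * Δ) t‖ ^ 2 := by
    intro ω
    rw [emInterp_eq_emNode_add hΔ ht.1, add_assoc, add_sub_cancel_left]
    refine (norm_add_sq_le_two_mul _ _).trans ?_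
    rw [norm_smul, mul_pow, Real.norm_of_nonneg hst, ← mul_assoc]
    gcongr
  refine (integral_mono (integrable_sq_norm ((memLp_emInterp hb hX₀ hB hΔ ht i).sub (h i)))
    (((integrable_sq_norm hβ).const_mul _).add ((integrable_sq_norm hζ).const_mul 2)) hpath).trans ?_
  simp only [Pi.add_apply]
  rw [integral_add ((integrable_sq_norm hβ).const_mul _) ((integrable_sq_norm hζ).const_mul 2),
    integral_const_mul, integral_const_mul]
  have := mul_le_mul_of_nonneg_left hβi (by positivity : 0 ≤ 2 * Δ ^ 2)
  linarith

/-- Needed for Tonelli: the interpolation has continuous paths, and the step process samples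
countably many nodes. -/
lemma aemeasurable_energy_emInterp_sub (hb : LipschitzCoefficients L b fun _ => ξ)
    (hX₀ : ∀ i, MemLp (X₀ i) 2 P) (hB : ∀ i, IsFBM P H T (B i)) (hΔ : 0 < Δ) (i : Fin N) :
    AEMeasurable (fun p : ℝ × Ω =>
      energy i (emInterp b ξ (fun j => X₀ j p.2) (fun j s => B j s p.2) Δ p.1
        - emStep b ξ (fun j => X₀ j p.2) (fun j s => B j s p.2) Δ p.1))
      ((volume.restrict (Icc 0 T)).prod P) := by
  have h1 : AEMeasurable (fun p : ℝ × Ω =>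
      emInterp b ξ (fun j => X₀ j p.2) (fun j s => B j s p.2) Δ p.1)
      ((volume.restrict (Icc 0 T)).prod P) := by
    refine aemeasurable_uncurry_of_continuousOn (Z := fun t ω =>
      emInterp b ξ (fun j => X₀ j ω) (fun j s => B j s ω) Δ t)
      (fun t ht => aemeasurable_pi_of_memLp (memLp_emInterp hb hX₀ hB hΔ ht)) ?_
    filter_upwards [ae_all_iff.2 fun j => (hB j).continuous_paths] with ω hω
    exact continuousOn_emInterp hb hΔ hω
  have h2 : AEMeasurable (fun p : ℝ × Ω =>
      emStep b ξ (fun j => X₀ j p.2) (fun j s => B j s p.2) Δ p.1)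
      ((volume.restrict (Icc 0 T)).prod P) := by
    refine aemeasurable_comp_nat (Z := fun k ω =>
      emNode b ξ (fun j => X₀ j ω) (fun j s => B j s ω) Δ k) (φ := fun s : ℝ => ⌊s / Δ⌋₊)
      (by fun_prop) ?_
    filter_upwards [ae_restrict_mem measurableSet_Icc] with s hs
    exact aemeasurable_pi_of_memLp (memLp_emStep hb hX₀ hB hΔ hs)
  exact (continuous_energy i).measurable.comp_aemeasurable (h1.sub h2)

/-- The mean square error of the Euler–Maruyama method is controlled by the distance of its
continuous to its piecewise constant extension. -/
lemma lintegral_sq_sub_emInterp_le {X : Fin N → ℝ → Ω → Vec d}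
    (hb : LipschitzCoefficients L b fun _ => ξ) (hX₀ : ∀ i, MemLp (X₀ i) 2 P)
    (hB : ∀ i, IsFBM P H T (B i)) (hX : IsParticleSystem P T b ξ X₀ B X) (hΔ : 0 < Δ) {Q : ℝ}
    (hQ : ∀ t ∈ Icc 0 T, ∀ i, ∫ ω, ‖emInterp b ξ (fun j => X₀ j ω) (fun j s => B j s ω) Δ t i
        - emStep b ξ (fun j => X₀ j ω) (fun j s => B j s ω) Δ t i‖ ^ 2 ∂P ≤ Q)
    {t : ℝ} (ht : t ∈ Icc 0 T) (i : Fin N) :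
    ∫⁻ ω, ENNReal.ofReal
        (‖X i t ω - emInterp b ξ (fun j => X₀ j ω) (fun j s => B j s ω) Δ t i‖ ^ 2) ∂P
      ≤ ENNReal.ofReal (12 * L ^ 2 * T * Real.exp (12 * L ^ 2 * T * T) * (2 * Q * T)) := by
  have hT : 0 ≤ T := ht.1.trans ht.2
  set K := 12 * L ^ 2 * T * Real.exp (12 * L ^ 2 * T * T) with hK
  have hK0 : 0 ≤ K := by positivity
  set F : ℝ → Ω → ℝ := fun s ω => energy i (emInterp b ξ (fun j => X₀ j ω) (fun j s => B j s ω) Δ s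
    - emStep b ξ (fun j => X₀ j ω) (fun j s => B j s ω) Δ s) with hF
  have hFm : AEMeasurable (fun p : ℝ × Ω => F p.1 p.2) ((volume.restrict (Icc 0 T)).prod P) :=
    aemeasurable_energy_emInterp_sub hb hX₀ hB hΔ i
  -- Stated in `[0, ∞]`, since no moment of `X` is known yet.
  have hae : ∀ᵐ ω ∂P, ENNReal.ofReal
      (‖X i t ω - emInterp b ξ (fun j => X₀ j ω) (fun j s => B j s ω) Δ t i‖ ^ 2)
      ≤ ENNReal.ofReal K * ∫⁻ s in Icc 0 T, ENNReal.ofReal (F s ω) := by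
    filter_upwards [ae_all_iff.2 fun j => (hB j).continuous_paths,
      ae_all_iff.2 hX.continuous_paths, ae_all_iff.2 hX.equation] with ω h1 h2 h3
    rw [← ofReal_integral_eq_lintegral_ofReal (integrableOn_energy_emInterp_sub hb hΔ h1 i)
      (.of_forall fun s => energy_nonneg _ _), ← ENNReal.ofReal_mul hK0]
    exact ENNReal.ofReal_le_ofReal
      (sq_norm_sub_emInterp_le (x := fun j s => X j s ω) hb hΔ h2 h1 h3 ht i)
  calc _ ≤ ∫⁻ ω, ENNReal.ofReal K * (∫⁻ s in Icc 0 T, ENNReal.ofReal (F s ω)) ∂P :=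
        lintegral_mono_ae hae
    _ = ENNReal.ofReal K * ∫⁻ s in Icc 0 T, (∫⁻ ω, ENNReal.ofReal (F s ω) ∂P) := by
        rw [lintegral_const_mul' _ _ ENNReal.ofReal_ne_top,
          lintegral_lintegral_swap (f := fun s ω => ENNReal.ofReal (F s ω)) hFm.ennreal_ofReal]
    _ ≤ ENNReal.ofReal K * ∫⁻ _ in Icc 0 T, ENNReal.ofReal (2 * Q) := by
        refine mul_le_mul_right (setLIntegral_mono_ae aemeasurable_const
          (.of_forall fun s hs => ?_)) _
        have hz : ∀ j, MemLp (fun ω => (emInterp b ξ (fun j => X₀ j ω) (fun j s => B j s ω) Δ s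
            - emStep b ξ (fun j => X₀ j ω) (fun j s => B j s ω) Δ s) j) 2 P := fun j =>
          (memLp_emInterp hb hX₀ hB hΔ hs j).sub (memLp_emStep hb hX₀ hB hΔ hs j)
        rw [← ofReal_integral_eq_lintegral_ofReal (integrable_energy hz i)
          (.of_forall fun s => energy_nonneg _ _)]
        exact ENNReal.ofReal_le_ofReal (integral_energy_le hz (hQ s hs) i)
    _ = ENNReal.ofReal (K * (2 * Q * T)) := by
        rw [setLIntegral_const, Real.volume_Icc, sub_zero, ENNReal.ofReal_mul hK0,
          ENNReal.ofReal_mul' hT]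

end Scheme

/-! ### Bounds uniform in the Hurst parameter -/

section Constants

lemma rpow_le_one_add {x p : ℝ} (hx : 0 ≤ x) (hp0 : 0 ≤ p) (hp1 : p ≤ 1) : x ^ p ≤ 1 + x :=
  calc x ^ p ≤ (1 + x) ^ p := Real.rpow_le_rpow hx (by linarith) hp0
    _ ≤ (1 + x) ^ (1 : ℝ) := Real.rpow_le_rpow_of_exponent_le (by linarith) hp1
    _ = 1 + x := Real.rpow_one _

/-- Absorbs `Δ ^ 2` into `Δ ^ (2 * H)`. The base `1 + T` is at least 1, so the exponent `2 - p` can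
be raised to 2 whatever the size of `T`, which removes `H` from the constant. -/
lemma sq_le_mul_rpow {x T p : ℝ} (hx : 0 < x) (hxT : x ≤ T) (hp0 : 0 ≤ p) (hp1 : p ≤ 2) :
    x ^ 2 ≤ (1 + T) ^ 2 * x ^ p :=
  calc x ^ 2 = x ^ (2 - p) * x ^ p := by
        rw [← Real.rpow_add hx, sub_add_cancel]; norm_num
    _ ≤ (1 + T) ^ 2 * x ^ p := by
        gcongr
        calc x ^ (2 - p) ≤ (1 + T) ^ (2 - p) :=
              Real.rpow_le_rpow hx.le (by linarith) (by linarith)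
          _ ≤ (1 + T) ^ (2 : ℝ) := Real.rpow_le_rpow_of_exponent_le (by linarith) (by linarith)
          _ = (1 + T) ^ 2 := by norm_num

end Constants

end FBMParticles
-- The convergence theorem
open FBMParticles in
theorem theorem3p13 (T L : ℝ) (hT : 0 < T) (hL : 0 < L) :
    ∃ C : ℝ, 0 < C ∧
      ∀ (H : ℝ) (_ : 0 < H) (_ : H < 1 / 2)
        (d N M : ℕ) [NeZero N] (_ : 0 < M)
        (b : Vec d → P2 d → Vec d) (ξ : Matrix (Fin d) (Fin d) ℝ)
        (_ : LipschitzCoefficients L b (fun _ => ξ))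
        (Ω : Type*) [MeasurableSpace Ω] (P : Measure Ω) [IsProbabilityMeasure P]
        (X₀ : Fin N → Ω → Vec d) (B X : Fin N → ℝ → Ω → Vec d)
        (_ : ∀ i, MemLp (X₀ i) 2 P)
        (_ : ∀ i j, IdentDistrib (X₀ i) (X₀ j) P P)
        (_ : ∀ i, IsFBM P H T (B i))
        (_ : IsParticleSystem P T b ξ X₀ B X),
      ∀ t ∈ Icc (0 : ℝ) T, ∀ i : Fin N,
        Integrable (fun ω => ‖X i t ω -
            emInterp b ξ (fun j => X₀ j ω) (fun j s => B j s ω) (T / M) t i‖ ^ 2) P ∧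
          ∫ ω, ‖X i t ω -
              emInterp b ξ (fun j => X₀ j ω) (fun j s => B j s ω) (T / M) t i‖ ^ 2 ∂P
            ≤ C * (1 + ∫ ω, ‖X₀ i ω‖ ^ 2 ∂P) * (T / M) ^ (2 * H) := by
  set K := 12 * L ^ 2 * T * Real.exp (12 * L ^ 2 * T * T) with hK
  -- Up to a factor `1 + m`, `c₀` dominates the constant of `integral_sq_emNode_le` for every `H`,
  -- `D₀` the moments of the nodes, and `Q₀`, with a further `Δ ^ (2 * H)`, the one-step distance.
  set c₀ := 3 + 3 * L ^ 2 * (1 + T) + 6 * T ^ 2 * L ^ 2 with hc₀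
  set D₀ := c₀ * Real.exp (24 * T * L ^ 2 * T) with hD₀
  set Q₀ := 2 * (1 + T) ^ 2 * (2 * L ^ 2 + 8 * L ^ 2 * D₀) + 2 * L ^ 2 with hQ₀
  have hD₀0 : 0 < D₀ := by positivity
  refine ⟨K * (2 * Q₀ * T), by positivity, ?_⟩
  intro H hH hH2 d N M _ hM b ξ hb Ω _ P _ X₀ B X hX₀ hid hB hX t ht i
  set Δ := T / M with hΔdef
  have hM1 : (1 : ℝ) ≤ M := by exact_mod_cast hM
  have hΔ : 0 < Δ := by positivity
  have hΔT : Δ ≤ T := div_le_self hT.le hM1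
  set m := ∫ ω, ‖X₀ i ω‖ ^ 2 ∂P with hm
  have hm0 : 0 ≤ m := integral_nonneg fun ω => by positivity
  -- Equality in law enters only here: one initial moment serves for all particles.
  have hmi : ∀ j, ∫ ω, ‖X₀ j ω‖ ^ 2 ∂P ≤ m := fun j =>
    ((hid j i).comp (u := fun v : Vec d => ‖v‖ ^ 2) (by fun_prop)).integral_eq.le
  have hD : ∀ s ∈ Icc 0 T, ∀ j,
      ∫ ω, ‖emStep b ξ (fun j => X₀ j ω) (fun j s => B j s ω) Δ s j‖ ^ 2 ∂P ≤ D₀ * (1 + m) := by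
    intro s hs j
    have hk := floor_div_mul_le hΔ hs
    refine (integral_sq_emNode_le hb hX₀ hmi hB hH hT.le hΔ _ hk j).trans ?_
    have h1 : 3 * m + 3 * L ^ 2 * T ^ (2 * H) + 6 * T ^ 2 * L ^ 2 ≤ c₀ * (1 + m) := by
      have h2 : 3 * L ^ 2 * T ^ (2 * H) ≤ 3 * L ^ 2 * (1 + T) := by
        gcongr
        exact rpow_le_one_add hT.le (by positivity) (by linarith)
      have h3 : 0 ≤ (3 * L ^ 2 * (1 + T) + 6 * T ^ 2 * L ^ 2) * m := by positivity
      rw [hc₀]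
      linarith
    have h4 : (1 + 24 * T * L ^ 2 * Δ) ^ ⌊s / Δ⌋₊ ≤ Real.exp (24 * T * L ^ 2 * T) :=
      calc (1 + 24 * T * L ^ 2 * Δ) ^ ⌊s / Δ⌋₊
          ≤ Real.exp (24 * T * L ^ 2 * Δ) ^ ⌊s / Δ⌋₊ := by
            gcongr
            linarith [Real.add_one_le_exp (24 * T * L ^ 2 * Δ)]
        _ = Real.exp (24 * T * L ^ 2 * (⌊s / Δ⌋₊ * Δ)) := by
            rw [← Real.exp_nat_mul]
            ring_nf
        _ ≤ _ := by gcongr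
    calc _ ≤ c₀ * (1 + m) * Real.exp (24 * T * L ^ 2 * T) := by gcongr
      _ = _ := by rw [hD₀]; ring
  have hQ : ∀ s ∈ Icc 0 T, ∀ j,
      ∫ ω, ‖emInterp b ξ (fun j => X₀ j ω) (fun j s => B j s ω) Δ s j
        - emStep b ξ (fun j => X₀ j ω) (fun j s => B j s ω) Δ s j‖ ^ 2 ∂P
      ≤ Q₀ * (1 + m) * Δ ^ (2 * H) := by
    intro s hs j
    refine (integral_sq_emInterp_sub_emStep_le hb hX₀ hB hH hΔ hs (hD s hs) j).trans ?_
    have h1 : 2 * L ^ 2 + 8 * L ^ 2 * (D₀ * (1 + m)) ≤ (2 * L ^ 2 + 8 * L ^ 2 * D₀) * (1 + m) := by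
      have : 0 ≤ L ^ 2 * m := by positivity
      linarith
    have h2 := sq_le_mul_rpow hΔ hΔT (p := 2 * H) (by positivity) (by linarith)
    have h3 : 0 ≤ 2 * L ^ 2 * m * Δ ^ (2 * H) := by positivity
    calc 2 * Δ ^ 2 * (2 * L ^ 2 + 8 * L ^ 2 * (D₀ * (1 + m))) + 2 * L ^ 2 * Δ ^ (2 * H)
        ≤ 2 * ((1 + T) ^ 2 * Δ ^ (2 * H)) * ((2 * L ^ 2 + 8 * L ^ 2 * D₀) * (1 + m))
          + 2 * L ^ 2 * Δ ^ (2 * H) := by gcongr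
      _ ≤ Q₀ * (1 + m) * Δ ^ (2 * H) := by
          rw [hQ₀]
          linarith
  have hlint := lintegral_sq_sub_emInterp_le hb hX₀ hB hX hΔ hQ ht i
  have hmeas : AEStronglyMeasurable (fun ω => ‖X i t ω -
      emInterp b ξ (fun j => X₀ j ω) (fun j s => B j s ω) Δ t i‖ ^ 2) P :=
    ((hX.measurable i t ht).aestronglyMeasurable.sub
      (memLp_emInterp hb hX₀ hB hΔ ht i).aestronglyMeasurable).norm.pow 2
  have hint : Integrable (fun ω => ‖X i t ω -
      emInterp b ξ (fun j => X₀ j ω) (fun j s => B j s ω) Δ t i‖ ^ 2) P := by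
    refine ⟨hmeas, ?_⟩
    rw [hasFiniteIntegral_iff_ofReal (.of_forall fun ω => by positivity)]
    exact hlint.trans_lt ENNReal.ofReal_lt_top
  refine ⟨hint, ?_⟩
  rw [← ofReal_integral_eq_lintegral_ofReal hint (.of_forall fun ω => by positivity),
    ENNReal.ofReal_le_ofReal_iff (by positivity)] at hlint
  calc _ ≤ _ := hlint
    _ = _ := by ring
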